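/- Let $\mathfrak O$ be a compact discrete valuation ring with maximal ideal $\mathfrak P$ and residue field of size $q$. Let $n\ge 0$ and $d_1,\dots,d_n\ge 0$ be integers, put $D_i=d_1+\dots+d_i$ for $0\le i\le n$ and $m=\max_i d_i$ (with $m=0$ if $n=0$), and suppose that $\gcd(q,(m-1)!)=1$ (no condition if $m=0$). **Orbit-counting zeta functions.** Let $\mathsf U_d$ be the group scheme over $\mathfrak O$ of upper unitriangular $d\times d$ matrices. Embed $\mathsf U_{d_1+1}\times\dots\times\mathsf U_{d_n+1}$ block-diagonally into matrices of size $\sum_i(d_i+1)$. For a group scheme $\mathsf G$ over $\mathfrak O$ embedded into $N\times N$ matrices, let $\mathsf Z^{\mathrm{oc}}_{\mathsf G}(Y)=\sum_{k\ge 0}b_k(\mathsf G)Y^k\in\mathbb Q[[Y]]$, where $b_k(\mathsf G)$ is the number of orbits of $\mathsf G(\mathfrak O/\mathfrak P^k)$ acting on row vectors in $(\mathfrak O/\mathfrak P^k)^N$ by right multiplication. The Hadamard product of power series $A_i(Y)=\sum_k a_{i,k}Y^k$ $(1\le i\le n)$ is $\sum_k\bigl(\prod_i a_{i,k}\bigr)Y^k$,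 denoted by $\mathop{\ast}_{i=1}^n A_i(Y)$. **Coloured permutations.** A coloured permutation is a string $\boldsymbol a=\sigma_1^{\gamma_1}\cdots\sigma_N^{\gamma_N}$ with distinct positive integers $\sigma_i$ (symbols) and integers $\gamma_i\ge 0$ (colours). Let $\mathrm{pal}^*(\boldsymbol a)=\{\gamma_1,\dots,\gamma_N\}\setminus\{0\}$. Order coloured integers by $\sigma^\gamma<\tau^\delta$ if and only if $\gamma>\delta$, or $\gamma=\delta$ and $\sigma<\tau$. Let $\mathrm{des}(\boldsymbol a)$ be the number of $i\in\{1,\dots,N-1\}$ with $\sigma_i^{\gamma_i}>\sigma_{i+1}^{\gamma_{i+1}}$, plus $1$ if $N\ge 1$ and $\gamma_1\ne 0$. Let $T$ be the set of all words that are (iterated) shuffles of the $n$ words $(D_{i-1}+1)(D_{i-1}+2)\cdots D_i$, $i=1,\dots,n$. For a set $P$ of words with distinct positive letters let $\Pi(P)$ be the set of all $\sigma_1^{\gamma_1}\cdots\sigma_N^{\gamma_N}$ with $\sigma_1\cdots\sigma_N\in P$ and $\gamma_i\in\{0,\sigma_i\}$ for all $i$. Then $T$ consists of words of permutations of $\{1,\dots,D_n\}$,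 $|T|=\prod_{i=1}^n\binom{D_i}{D_{i-1}}$, and $$\mathsf Z^{\mathrm{oc}}_{\mathsf U_{d_1+1}\times\dots\times\mathsf U_{d_n+1}}(q^{-n}Y)=\mathop{\ast}_{i=1}^n\mathsf Z^{\mathrm{oc}}_{\mathsf U_{d_i+1}}(q^{-1}Y)=\frac{\sum_{\boldsymbol a\in\Pi(T)}(-q)^{-|\mathrm{pal}^*(\boldsymbol a)|}\,Y^{\mathrm{des}(\boldsymbol a)}}{(1-Y)^{D_n+1}}.$$ -/

import Mathlib

open scoped PowerSeries

namespace ColouredShuffle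

universe u

/-! ### Coloured permutations

A coloured positive integer `σ^γ` is a pair `(σ, γ) : ℕ × ℕ` with symbol `σ ≥ 1` and colour `γ`.
Strings of coloured integers are lists of such pairs, and uncoloured strings are lists of
natural numbers. -/

/-- A coloured permutation: a string of coloured positive integers with distinct symbols. -/
def IsColouredPerm (a : List (ℕ × ℕ)) : Prop :=
  (∀ x ∈ a, 1 ≤ x.1) ∧ (a.map Prod.fst).Nodup

/-- The colour order `⋯ < 1^1 < 2^1 < ⋯ < 1^0 < 2^0 < ⋯` on coloured integers. -/
def colourLT (x y : ℕ × ℕ) : Prop :=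
  y.2 < x.2 ∨ (x.2 = y.2 ∧ x.1 < y.1)

instance : DecidableRel colourLT := fun x y =>
  inferInstanceAs (Decidable (y.2 < x.2 ∨ (x.2 = y.2 ∧ x.1 < y.1)))

/-- The descent set of `a = a₁ ⋯ aₙ`: all `1 ≤ i ≤ n - 1` with `aᵢ > aᵢ₊₁` in the colour order,
together with `0` if `n ≥ 1` and the colour of `a₁` is not `0`. (The `i`-th letter of `a`, counted
from `1`, is the entry of the list at position `i - 1`.) -/
def Des (a : List (ℕ × ℕ)) : Finset ℕ :=
  {i ∈ Finset.Icc 1 (a.length - 1) | colourLT (a.getD i (0, 0)) (a.getD (i - 1) (0, 0))} ∪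
    (if ∃ x ∈ a.head?, x.2 ≠ 0 then {0} else ∅)

/-- The descent number. -/
def des (a : List (ℕ × ℕ)) : ℕ := (Des a).card

/-- The set of colours occurring in `a`. -/
def palette (a : List (ℕ × ℕ)) : Finset ℕ := (a.map Prod.snd).toFinset

/-- The set of nonzero colours occurring in `a`. -/
def paletteStar (a : List (ℕ × ℕ)) : Finset ℕ := (palette a).erase 0

/-- The words `σ₁ ⋯ σ_N` with `{σ₁, …, σ_N} = {1, …, N}`. -/
def symmWords (N : ℕ) : Finset (List ℕ) := (List.range' 1 N).permutations.toFinset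

theorem mem_symmWords {N : ℕ} {w : List ℕ} :
    w ∈ symmWords N ↔ w.Perm (List.range' 1 N) := by
  simp [symmWords]

/-- All shuffles of two words. -/
def shuffles {α : Type*} : List α → List α → List (List α)
  | [], v => [v]
  | u, [] => [u]
  | a :: u, b :: v =>
    (shuffles u (b :: v)).map (a :: ·) ++ (shuffles (a :: u) v).map (b :: ·)
  termination_by u v => u.length + v.length

/-- All shuffles of a word from `P` with a word from `Q`. -/
def shuffleSet (P Q : Finset (List ℕ)) : Finset (List ℕ) :=
  P.biUnion fun u => Q.biUnion fun v => (shuffles u v).toFinset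

/-- `D_i = d_1 + ⋯ + d_i`; the number `d_j` is `d (j - 1)`. -/
def partialSum {n : ℕ} (d : Fin n → ℕ) (i : ℕ) : ℕ :=
  ∑ j : Fin n with j.val < i, d j

/-- The iterated shuffle of the `n` words `(D_{i-1} + 1) ⋯ D_i`, `i = 1, …, n`. -/
def blockShuffle {n : ℕ} (d : Fin n → ℕ) : Finset (List ℕ) :=
  (List.ofFn fun i : Fin n =>
    ({List.range' (partialSum d i + 1) (d i)} : Finset (List ℕ))).foldl shuffleSet {[]}

/-- `Π(P)`: all `σ₁^γ₁ ⋯ σ_N^γ_N` with `σ₁ ⋯ σ_N ∈ P` and `γᵢ ∈ {0, σᵢ}` for all `i`. -/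
def colourings (P : Finset (List ℕ)) : Finset (List (ℕ × ℕ)) :=
  P.biUnion fun w => (w.map fun s => [(s, 0), (s, s)]).sections.toFinset

theorem mem_colourings {P : Finset (List ℕ)} {a : List (ℕ × ℕ)} :
    a ∈ colourings P ↔ a.map Prod.fst ∈ P ∧ ∀ x ∈ a, x.2 = 0 ∨ x.2 = x.1 := by
  have key : ∀ (w : List ℕ) (a : List (ℕ × ℕ)),
      a ∈ (w.map fun s => [(s, 0), (s, s)]).sections ↔
        a.map Prod.fst = w ∧ ∀ x ∈ a, x.2 = 0 ∨ x.2 = x.1 := by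
    intro w a
    rw [List.mem_sections]
    induction a generalizing w with
    | nil => cases w <;> simp
    | cons x a ih =>
      cases w with
      | nil => simp
      | cons s w =>
        obtain ⟨x1, x2⟩ := x
        simp only [List.map_cons, List.forall₂_cons, ih w]
        simp
        grind
  simp only [colourings, Finset.mem_biUnion, List.mem_toFinset, key]
  grind

theorem isColouredPerm_of_mem_colourings {N : ℕ} {P : Finset (List ℕ)} (hP : P ⊆ symmWords N)
    {a : List (ℕ × ℕ)} (ha : a ∈ colourings P) : IsColouredPerm a := by
  have h := mem_symmWords.1 (hP (mem_colourings.1 ha).1)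
  refine ⟨fun x hx => ?_, h.nodup_iff.2 List.nodup_range'⟩
  have := h.subset (List.mem_map_of_mem hx)
  simp only [List.mem_range'_1] at this
  exact this.1

/-! ### Linear group schemes and their orbit-counting zeta functions -/

/-- A linear group scheme over `O`, embedded into `ι × ι` matrices: a closed subgroup scheme of
`GL_ι` over `O`, given by its groups of points in `O`-algebras, which are cut out of `GL_ι`
by a set of polynomial equations over `O` in the matrix entries. -/
structure LinearGroupScheme (O : Type u) [CommRing O] (ι : Type) [Fintype ι] [DecidableEq ι] where
  points : ∀ (R : Type u) [CommRing R] [Algebra O R], Subgroup (GL ι R)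
  exists_equations : ∃ E : Set (MvPolynomial (ι × ι) O),
    ∀ (R : Type u) [CommRing R] [Algebra O R] (g : GL ι R),
      g ∈ points R ↔ ∀ f ∈ E, MvPolynomial.aeval (fun p : ι × ι => g.1 p.1 p.2) f = 0

/-- The action of a group of invertible matrices on row vectors by right multiplication
(a right action, hence an action of the opposite group). -/
@[reducible] def rightMulAction {ι R : Type*} [Fintype ι] [DecidableEq ι] [CommRing R]
    (H : Subgroup (GL ι R)) : MulAction (↥H)ᵐᵒᵖ (ι → R) where
  smul g v := Matrix.vecMul v g.unop.1.1
  one_smul v := Matrix.vecMul_one v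
  mul_smul g h v := (Matrix.vecMul_vecMul v h.unop.1.1 g.unop.1.1).symm

/-- The number of orbits of a group of invertible matrices acting on row vectors by right
multiplication. -/
noncomputable def numOrbits {ι R : Type*} [Fintype ι] [DecidableEq ι] [CommRing R]
    (H : Subgroup (GL ι R)) : ℕ :=
  letI := rightMulAction H
  Nat.card (MulAction.orbitRel.Quotient (↥H)ᵐᵒᵖ (ι → R))

/-- The orbit-counting zeta function `∑ₖ bₖ Yᵏ`, where `bₖ` is the number of orbits of
`G(O / 𝔓ᵏ)` on `(O / 𝔓ᵏ)^ι` and `𝔓` is the maximal ideal of `O`. -/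
noncomputable def orbitZeta {O : Type u} [CommRing O] [IsLocalRing O] {ι : Type} [Fintype ι]
    [DecidableEq ι] (G : LinearGroupScheme O ι) : ℚ⟦X⟧ :=
  PowerSeries.mk fun k => (numOrbits (G.points (O ⧸ IsLocalRing.maximalIdeal O ^ k)) : ℚ)

/-- Upper unitriangular `d × d` matrices. -/
def unitriangularSubgroup (d : ℕ) (R : Type*) [CommRing R] : Subgroup (GL (Fin d) R) where
  carrier := {g | (∀ i j, j < i → g.1 i j = 0) ∧ ∀ i, g.1 i i = 1}
  one_mem' := by
    refine ⟨fun i j h => ?_, fun i => ?_⟩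
    · simp [Matrix.one_apply_ne h.ne']
    · simp
  mul_mem' := by
    rintro a b ⟨ha, ha'⟩ ⟨hb, hb'⟩
    refine ⟨fun i j h => ?_, fun i => ?_⟩
    · simp only [Units.val_mul, Matrix.mul_apply]
      refine Finset.sum_eq_zero fun k _ => ?_
      rcases lt_or_ge k i with hk | hk
      · rw [ha i k hk, zero_mul]
      · rw [hb k j (h.trans_le hk), mul_zero]
    · simp only [Units.val_mul, Matrix.mul_apply]
      rw [Finset.sum_eq_single i, ha', hb', one_mul]
      · intro k _ hk
        rcases lt_or_gt_of_ne hk with hk | hk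
        · rw [ha i k hk, zero_mul]
        · rw [hb k i hk, mul_zero]
      · simp
  inv_mem' := by
    rintro a ⟨ha, ha'⟩
    have hinv : ∀ i j, j < i → a⁻¹.1 i j = 0 := by
      have h1 : Matrix.BlockTriangular a.1 id := fun i j h => ha i j h
      let : Invertible a.1 := a.invertible
      have h2 := Matrix.blockTriangular_inv_of_blockTriangular h1
      rw [← Matrix.coe_units_inv] at h2
      exact fun i j h => h2 h
    refine ⟨hinv, fun i => ?_⟩
    have h : (a⁻¹.1 * a.1) i i = 1 := by
      rw [← Units.val_mul, inv_mul_cancel, Units.val_one, Matrix.one_apply_eq]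
    rw [Matrix.mul_apply, Finset.sum_eq_single i, ha', mul_one] at h
    · exact h
    · intro k _ hk
      rcases lt_or_gt_of_ne hk with hk | hk
      · rw [hinv i k hk, zero_mul]
      · rw [ha k i hk, mul_zero]
    · simp

/-- The group scheme `U_d` of upper unitriangular `d × d` matrices. -/
def unitriangular (O : Type u) [CommRing O] (d : ℕ) : LinearGroupScheme O (Fin d) where
  points R _ _ := unitriangularSubgroup d R
  exists_equations := by
    refine ⟨{f | (∃ i j : Fin d, j < i ∧ f = MvPolynomial.X (i, j)) ∨
      ∃ i : Fin d, f = MvPolynomial.X (i, i) - 1}, fun R _ _ g => ⟨?_, fun h => ⟨?_, ?_⟩⟩⟩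
    · rintro ⟨h1, h2⟩ f (⟨i, j, hij, rfl⟩ | ⟨i, rfl⟩)
      · simpa using h1 i j hij
      · simpa [sub_eq_zero] using h2 i
    · intro i j hij
      simpa using h _ (Or.inl ⟨i, j, hij, rfl⟩)
    · intro i
      simpa [sub_eq_zero] using h _ (Or.inr ⟨i, rfl⟩)

/-- The diagonal embedding of a product of general linear groups. -/
def blockDiagonalGL {κ : Type} [Fintype κ] [DecidableEq κ] (ι : κ → Type)
    [∀ k, Fintype (ι k)] [∀ k, DecidableEq (ι k)] (R : Type*) [CommRing R] :
    (∀ k, GL (ι k) R) →* GL (Σ k, ι k) R :=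
  (Units.map (Matrix.blockDiagonal'RingHom ι R).toMonoidHom).comp
    MulEquiv.piUnits.symm.toMonoidHom

theorem blockDiagonalGL_coe {κ : Type} [Fintype κ] [DecidableEq κ] (ι : κ → Type)
    [∀ k, Fintype (ι k)] [∀ k, DecidableEq (ι k)] (R : Type*) [CommRing R]
    (g : ∀ k, GL (ι k) R) :
    (blockDiagonalGL ι R g).1 = Matrix.blockDiagonal' fun k => (g k).1 := rfl

/-- The product of linear group schemes, diagonally embedded. -/
def LinearGroupScheme.prod {O : Type u} [CommRing O] {κ : Type} [Fintype κ] [DecidableEq κ]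
    {ι : κ → Type} [∀ k, Fintype (ι k)] [∀ k, DecidableEq (ι k)]
    (G : ∀ k, LinearGroupScheme O (ι k)) : LinearGroupScheme O (Σ k, ι k) where
  points R _ _ := (Subgroup.pi Set.univ fun k => (G k).points R).map (blockDiagonalGL ι R)
  exists_equations := by
    choose E hE using fun k => (G k).exists_equations
    refine ⟨{f | (∃ k, ∃ e ∈ E k,
        f = MvPolynomial.rename (fun p : ι k × ι k => (⟨k, p.1⟩, ⟨k, p.2⟩)) e) ∨
      ∃ i j : (Σ k, ι k), i.1 ≠ j.1 ∧ f = MvPolynomial.X (i, j)}, fun R _ _ g => ⟨?_, fun h => ?_⟩⟩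
    · rintro ⟨x, hx, rfl⟩ f (⟨k, e, he, rfl⟩ | ⟨⟨i, i'⟩, ⟨j, j'⟩, hij, rfl⟩)
      · have := (hE k R (x k)).1 (hx k (Set.mem_univ k)) e he
        rw [MvPolynomial.aeval_rename]
        simpa [Function.comp_def, blockDiagonalGL_coe] using this
      · simpa [blockDiagonalGL_coe] using Matrix.blockDiagonal'_apply_ne _ i' j' hij
    · have hoff : ∀ i j : (Σ k, ι k), i.1 ≠ j.1 → g.1 i j = 0 := fun i j hij => by
        simpa using h _ (Or.inr ⟨i, j, hij, rfl⟩)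
      have hone : ∀ (k : κ), Matrix.blockDiag' (1 : Matrix (Σ k, ι k) (Σ k, ι k) R) k = 1 := by
        intro k
        rw [Matrix.blockDiag'_one]; rfl
      have h1 : ∀ k, Matrix.blockDiag' g.1 k * Matrix.blockDiag' g⁻¹.1 k = 1 := by
        intro k
        rw [← hone k, ← Units.val_one, ← mul_inv_cancel g, Units.val_mul]
        ext i j
        simp only [Matrix.mul_apply, Matrix.blockDiag'_apply, Fintype.sum_sigma]
        rw [Finset.sum_eq_single k]
        · exact fun l _ hl => Finset.sum_eq_zero fun m _ => by
            rw [hoff ⟨k, i⟩ ⟨l, m⟩ (Ne.symm hl), zero_mul]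
        · simp
      have h2 : ∀ k, Matrix.blockDiag' g⁻¹.1 k * Matrix.blockDiag' g.1 k = 1 := fun k =>
        mul_eq_one_comm.1 (h1 k)
      refine ⟨fun k => ⟨_, _, h1 k, h2 k⟩, fun k _ => ?_, ?_⟩
      · refine (hE k R _).2 fun e he => ?_
        have := h _ (Or.inl ⟨k, e, he, rfl⟩)
        rw [MvPolynomial.aeval_rename] at this
        exact this
      · apply Units.ext
        rw [blockDiagonalGL_coe]
        ext ⟨i, i'⟩ ⟨j, j'⟩
        rcases eq_or_ne i j with rfl | hij
        · simp [Matrix.blockDiag'_apply]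
        · rw [Matrix.blockDiagonal'_apply_ne _ _ _ hij, hoff _ _ hij]

/-- The (coefficientwise) Hadamard product of a finite family of power series. -/
noncomputable def hadamardProd {n : ℕ} (A : Fin n → ℚ⟦X⟧) : ℚ⟦X⟧ :=
  PowerSeries.mk fun k => ∏ i, PowerSeries.coeff k (A i)

end ColouredShuffle

namespace ColouredShuffle

/-! ### Shuffles of words and products of chain sums -/

section Shuffles

variable {α : Type*}

/-! The proof has two independent halves, each a generating function identity.

Orbits. A unitriangular matrix changes the `j`-th entry of `y` by an arbitrary element of the ideal
generated by the earlier entries, independently for each `j`. Counting orbits as the sum of inverse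
orbit sizes therefore gives a recursion on the first entry, indexed by ideals (`prefixSum_succ`).
Over `O ⧸ 𝔓 ^ k` the ideals form a chain, and the recursion is convolution with `(1 - Y) / (1 -
qY)`. Hence the zeta function of `U_d` is `(1 - Y)^(d - 1) / (1 - qY)^d`, and that of `U_{d+1}` at
`q⁻¹Y` is `(1 + tY)^d / (1 - Y)^(d + 1)` with `t = (-q)⁻¹`. Orbits of a block-diagonal product are
tuples of orbits, which yields the Hadamard product.

Shuffles. In the style of `P`-partitions, assign values in `0, …, k` to the letters of a coloured
word, weakly increasing along it and strictly increasing at descents. Such assignments are strictly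
increasing chains of positions (value, coloured letter), and they are counted by the coefficient of
`Y^k` in `Y^des / (1 - Y)^(N + 1)` (`chainSum_colouredPositions`). Two chains on disjoint letters
merge into a unique chain on a shuffle of the two words, so products of coefficients become sums
over shuffles (`chainSum_mul_chainSum`). Summing over colourings with weight `t` per coloured letter
preserves this. For an increasing word of length `d`, the descents are exactly the coloured letters,
which gives `(1 + tY)^d / (1 - Y)^(d + 1)`, the series found on the orbit side. -/

theorem shuffles_nil_left (v : List α) : shuffles [] v = [v] := by simp [shuffles]

theorem shuffles_nil_right (u : List α) : shuffles u [] = [u] := by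
  cases u <;> simp [shuffles]

theorem shuffles_cons_cons (a b : α) (u v : List α) :
    shuffles (a :: u) (b :: v) =
      (shuffles u (b :: v)).map (a :: ·) ++ (shuffles (a :: u) v).map (b :: ·) := by
  rw [shuffles]

theorem perm_append_of_mem_shuffles {u v c : List α} (h : c ∈ shuffles u v) :
    c.Perm (u ++ v) := by
  induction u, v using shuffles.induct generalizing c with
  | case1 v => simp_all [shuffles_nil_left]
  | case2 u _ => simp_all [shuffles_nil_right]
  | case3 a u b v ih1 ih2 =>
    rw [shuffles_cons_cons, List.mem_append, List.mem_map, List.mem_map] at h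
    rcases h with ⟨c, hc, rfl⟩ | ⟨c, hc, rfl⟩
    · exact (ih1 hc).cons a
    · exact ((ih2 hc).cons b).trans List.perm_middle.symm

theorem length_shuffles (u v : List α) :
    (shuffles u v).length = (u.length + v.length).choose u.length := by
  induction u, v using shuffles.induct with
  | case1 v => simp [shuffles_nil_left]
  | case2 u _ => simp [shuffles_nil_right]
  | case3 a u b v ih1 ih2 =>
    rw [shuffles_cons_cons, List.length_append, List.length_map, List.length_map, ih1, ih2]
    simp only [List.length_cons]
    rw [show u.length + 1 + (v.length + 1) = (u.length + 1 + v.length) + 1 by ring,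
      Nat.choose_succ_succ]
    congr 2; ring

theorem nodup_shuffles {u v : List α} (h : u.Disjoint v) : (shuffles u v).Nodup := by
  induction u, v using shuffles.induct with
  | case1 v => simp [shuffles_nil_left]
  | case2 u _ => simp [shuffles_nil_right]
  | case3 a u b v ih1 ih2 =>
    rw [shuffles_cons_cons, List.nodup_append]
    refine ⟨(ih1 (List.disjoint_of_disjoint_cons_left h)).map (List.cons_injective),
      (ih2 (List.disjoint_of_disjoint_cons_right h)).map (List.cons_injective), ?_⟩
    intro x hx y hy
    simp only [List.mem_map] at hx hy
    obtain ⟨c, -, rfl⟩ := hx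
    obtain ⟨e, -, rfl⟩ := hy
    intro he
    have : a = b := (List.cons.inj he).1
    subst this
    exact h (List.mem_cons_self) (List.mem_cons_self)

/-- Shuffling keeps the order inside each factor, so a factor can be recovered from its letters;
distinct `u` thus give disjoint sets of shuffles. -/
theorem filter_of_mem_shuffles {u v c : List α} (p : α → Bool) (hu : ∀ x ∈ u, p x = true)
    (hv : ∀ x ∈ v, p x = false) (h : c ∈ shuffles u v) : c.filter p = u := by
  induction u, v using shuffles.induct generalizing c with
  | case1 v =>
    rw [shuffles_nil_left, List.mem_singleton] at h
    subst h
    simpa using hv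
  | case2 u _ =>
    rw [shuffles_nil_right, List.mem_singleton] at h
    subst h
    simpa using hu
  | case3 a u b v ih1 ih2 =>
    rw [shuffles_cons_cons, List.mem_append, List.mem_map, List.mem_map] at h
    rcases h with ⟨c, hc, rfl⟩ | ⟨c, hc, rfl⟩
    · rw [List.filter_cons_of_pos (hu a (by simp)),
        ih1 (fun x hx => hu x (by simp [hx])) hv hc]
    · rw [List.filter_cons_of_neg (by simp [hv b (by simp)]),
        ih2 hu (fun x hx => hv x (by simp [hx])) hc]

/-- The weighted sum over all increasing chains `p < r₁ < r₂ < ⋯` such that `rᵢ` is an admissible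
position of the `i`-th letter of a word. -/
def chainSum {P : Type*} [LinearOrder P] (S : α → Finset P) (wt : P → ℚ) : List α → P → ℚ
  | [], _ => 1
  | x :: w, p => ∑ r ∈ S x with p < r, wt r * chainSum S wt w r

/-- Two chains starting above `p` merge in exactly one way, because disjointness of the position
sets excludes ties; the merging pattern is a shuffle. -/
theorem chainSum_mul_chainSum {P : Type*} [LinearOrder P] (S : α → Finset P) (wt : P → ℚ)
    {u v : List α} (h : ∀ x ∈ u, ∀ y ∈ v, Disjoint (S x) (S y)) (p : P) :
    chainSum S wt u p * chainSum S wt v p =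
      ((shuffles u v).map fun c => chainSum S wt c p).sum := by
  have hcons : ∀ (x : α) (L : List (List α)) (p : P),
      ((L.map (x :: ·)).map fun c => chainSum S wt c p).sum =
        ∑ r ∈ S x with p < r, wt r * (L.map fun c => chainSum S wt c r).sum := by
    intro x L p
    induction L with
    | nil => simp
    | cons w L ih =>
      simp only [List.map_cons, List.sum_cons, mul_add, Finset.sum_add_distrib, ← ih]
      rfl
  induction u, v using shuffles.induct generalizing p with
  | case1 v => simp [shuffles_nil_left, chainSum]
  | case2 u _ => simp [shuffles_nil_right, chainSum]
  | case3 a u b v ih1 ih2 =>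
    rw [shuffles_cons_cons, List.map_append, List.sum_append, hcons, hcons]
    simp only [← ih1 (fun x hx y hy => h x (by simp [hx]) y hy),
      ← ih2 (fun x hx y hy => h x hx y (by simp [hy]))]
    simp only [chainSum, Finset.sum_mul_sum]
    have hab := h a (by simp) b (by simp)
    -- Split by which chain has the smaller first element, `r` or `t`: this decides the first letter
    -- of the shuffle.
    have hsplit : ∀ r ∈ (S a).filter (p < ·), ∑ t ∈ S b with p < t,
        wt r * chainSum S wt u r * (wt t * chainSum S wt v t) =
        (∑ t ∈ S b with r < t, wt r * chainSum S wt u r * (wt t * chainSum S wt v t)) +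
        ∑ t ∈ S b with p < t ∧ t < r, wt r * chainSum S wt u r * (wt t * chainSum S wt v t) := by
      intro r hr
      rw [Finset.mem_filter] at hr
      rw [← Finset.sum_union]
      · refine Finset.sum_congr ?_ fun _ _ => rfl
        ext t
        simp only [Finset.mem_filter, Finset.mem_union]
        constructor
        · rintro ⟨ht, hpt⟩
          rcases lt_trichotomy r t with h1 | h1 | h1
          · exact Or.inl ⟨ht, h1⟩
          · subst h1
            exact absurd ht (Finset.disjoint_left.1 hab hr.1)
          · exact Or.inr ⟨ht, hpt, h1⟩
        · rintro (⟨ht, h1⟩ | ⟨ht, h1, -⟩)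
          · exact ⟨ht, hr.2.trans h1⟩
          · exact ⟨ht, h1⟩
      · rw [Finset.disjoint_filter]
        exact fun t _ h1 h2 => lt_asymm h1 h2.2
    rw [Finset.sum_congr rfl hsplit, Finset.sum_add_distrib]
    congr 1
    · refine Finset.sum_congr rfl fun r _ => ?_
      rw [Finset.mul_sum, Finset.mul_sum]
      refine Finset.sum_congr rfl fun t _ => ?_
      ring
    · rw [Finset.sum_comm' (t' := (S b).filter (p < ·)) (s' := fun t => (S a).filter (t < ·))]
      · refine Finset.sum_congr rfl fun t _ => ?_
        rw [Finset.sum_mul, Finset.mul_sum]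
        refine Finset.sum_congr rfl fun r _ => ?_
        ring
      · intro r t
        simp only [Finset.mem_filter]
        constructor
        · rintro ⟨⟨h1, h2⟩, h3, h4, h5⟩
          exact ⟨⟨h1, h5⟩, h3, h4⟩
        · rintro ⟨⟨h1, h5⟩, h3, h4⟩
          exact ⟨⟨h1, h4.trans h5⟩, h3, h4, h5⟩

end Shuffles

/-! ### Coloured words, descents and chains of positions -/

section Descents

/-- The descent number of a coloured word relative to a coloured letter put in front of it. -/
def desAfter : ℕ × ℕ → List (ℕ × ℕ) → ℕ
  | _, [] => 0
  | x, y :: a => (if colourLT y x then 1 else 0) + desAfter y a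

theorem sum_range_descent (x : ℕ × ℕ) (a : List (ℕ × ℕ)) :
    ∑ i ∈ Finset.range a.length,
      (if colourLT ((x :: a).getD (i + 1) (0, 0)) ((x :: a).getD i (0, 0)) then 1 else 0) =
      desAfter x a := by
  induction a generalizing x with
  | nil => rfl
  | cons y a ih =>
    rw [List.length_cons, Finset.sum_range_succ', desAfter, ← ih y, add_comm]
    rfl

/-- A letter is smaller than `(0, 0)` exactly when its colour is nonzero, so putting `(0, 0)` in
front makes the exceptional descent at `0` an ordinary one. -/
theorem des_eq_desAfter (a : List (ℕ × ℕ)) : des a = desAfter (0, 0) a := by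
  cases a with
  | nil => rfl
  | cons x a =>
    rw [des, Des, Finset.card_union_of_disjoint, desAfter, add_comm]
    · congr 1
      · simp only [List.head?_cons, Option.mem_def, Option.some.injEq, exists_eq_left', colourLT,
          Nat.pos_iff_ne_zero, not_lt_zero, and_false, or_false]
        split_ifs <;> simp_all
      · rw [← sum_range_descent, Finset.card_filter, ← Finset.Ico_add_one_right_eq_Icc,
          Finset.sum_Ico_eq_sum_range]
        simp [add_comm 1]
    · rw [Finset.disjoint_left]
      intro i hi
      have : 1 ≤ i := by simp at hi; exact hi.1.1
      split_ifs
      · simp; lia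
      · simp

/-- A coloured letter placed at a value. The order compares values first and coloured letters
second. -/
abbrev Position := ℕ ×ₗ (ℕᵒᵈ ×ₗ ℕ)

/-- The position of the coloured letter `x` at the value `v`. -/
def position (v : ℕ) (x : ℕ × ℕ) : Position := toLex (v, toLex (OrderDual.toDual x.2, x.1))

theorem position_lt_position {v w : ℕ} {x y : ℕ × ℕ} :
    position v x < position w y ↔ v < w ∨ v = w ∧ colourLT x y := by
  simp [position, Prod.Lex.toLex_lt_toLex, colourLT]

theorem position_injective2 : Function.Injective2 position := by
  intro v w x y h
  simp only [position, EmbeddingLike.apply_eq_iff_eq, Prod.mk.injEq] at h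
  exact ⟨h.1, Prod.ext h.2.2 h.2.1⟩

theorem coeff_mk_one_mul (G : ℚ⟦X⟧) (n : ℕ) :
    PowerSeries.coeff n (PowerSeries.mk 1 * G) =
      ∑ j ∈ Finset.range (n + 1), PowerSeries.coeff j G := by
  rw [mul_comm, PowerSeries.coeff_mul, Finset.Nat.sum_antidiagonal_eq_sum_range_succ_mk]
  simp

theorem coeff_X_pow_mul_mk_one_mul (G : ℚ⟦X⟧) (s e k : ℕ) (hs : s ≤ k) :
    PowerSeries.coeff (k - s) (PowerSeries.X ^ e * (PowerSeries.mk 1 * G)) =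
      ∑ v ∈ Finset.Ico (s + e) (k + 1), PowerSeries.coeff (k - v) G := by
  rw [PowerSeries.coeff_X_pow_mul']
  split_ifs with h
  · rw [coeff_mk_one_mul, ← Finset.sum_range_reflect, Finset.sum_Ico_eq_sum_range]
    rw [show k + 1 - (s + e) = k - s - e + 1 by lia]
    refine Finset.sum_congr rfl fun i hi => ?_
    congr 1
    rw [Finset.mem_range] at hi
    lia
  · rw [Finset.Ico_eq_empty (by lia), Finset.sum_empty]

/-- The positions of a coloured letter with values at most `k`. -/
def colouredPositions (k : ℕ) (x : ℕ × ℕ) : Finset Position :=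
  (Finset.range (k + 1)).image fun v => position v x

/-- Passing from one letter to the next, the value may stay or grow, but must grow at a descent:
each step contributes `1 / (1 - X)`, with a factor `X` at a descent. The last `1 / (1 - X)` absorbs
the slack below `k`. -/
theorem chainSum_colouredPositions (k : ℕ) (a : List (ℕ × ℕ)) (s : ℕ) (hs : s ≤ k) (x : ℕ × ℕ)
    (h : ((x :: a).map Prod.fst).Nodup) :
    chainSum (colouredPositions k) (fun _ => 1) a (position s x) =
      PowerSeries.coeff (k - s)
        (PowerSeries.X ^ desAfter x a * PowerSeries.mk 1 ^ (a.length + 1) : ℚ⟦X⟧) := by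
  induction a generalizing s x with
  | nil => simp [chainSum, desAfter]
  | cons y a ih =>
    have hxy : x.1 ≠ y.1 := by simp at h; exact h.1.1
    have hyn : ((y :: a).map Prod.fst).Nodup := by
      rw [List.map_cons] at h; exact h.of_cons
    rw [chainSum, desAfter, pow_add, List.length_cons, pow_succ' _ (a.length + 1),
      show ∀ A B C D : ℚ⟦X⟧, A * B * (C * D) = A * (C * (B * D)) by intros; ring,
      coeff_X_pow_mul_mk_one_mul _ _ _ _ hs]
    -- Since `x` and `y` have different symbols, comparison at equal values is decided by `colourLT`
    -- alone, so admissible values start at `s`, or at `s + 1` for a descent.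
    have hset : (colouredPositions k y).filter (position s x < ·) =
        (Finset.Ico (s + if colourLT y x then 1 else 0) (k + 1)).image fun v => position v y := by
      ext r
      simp only [colouredPositions, Finset.mem_filter, Finset.mem_image, Finset.mem_range,
        Finset.mem_Ico]
      constructor
      · rintro ⟨⟨v, hv, rfl⟩, hlt⟩
        refine ⟨v, ⟨?_, hv⟩, rfl⟩
        rw [position_lt_position] at hlt
        unfold colourLT at *
        split_ifs <;> lia
      · rintro ⟨v, ⟨hv1, hv⟩, rfl⟩
        refine ⟨⟨v, hv, rfl⟩, ?_⟩
        rw [position_lt_position]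
        unfold colourLT at *
        split_ifs at hv1 <;> lia
    rw [hset, Finset.sum_image fun v _ w _ hvw => (position_injective2 hvw).1]
    refine Finset.sum_congr rfl fun v hv => ?_
    rw [Finset.mem_Ico] at hv
    rw [one_mul, ih v (by lia) y hyn]

/-- The positions of the letter `x` with colours `0` and `x` and values at most `k`. -/
def letterPositions (k : ℕ) (x : ℕ) : Finset Position :=
  colouredPositions k (x, 0) ∪ colouredPositions k (x, x)

/-- The weight of a colour: `1` for the colour `0` and `t` for every other colour. -/
def colourWeight (t : ℚ) (c : ℕ) : ℚ := if c = 0 then 1 else t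

/-- The weight of the colour of a position. -/
def positionWeight (t : ℚ) (r : Position) : ℚ :=
  colourWeight t (OrderDual.ofDual (ofLex (ofLex r).2).1)

theorem disjoint_colouredPositions (k l : ℕ) {x y : ℕ × ℕ} (h : x ≠ y) :
    Disjoint (colouredPositions k x) (colouredPositions l y) := by
  rw [Finset.disjoint_left]
  simp only [colouredPositions, Finset.mem_image]
  rintro _ ⟨v, -, rfl⟩ ⟨w, -, hw⟩
  exact h (position_injective2 hw).2.symm

theorem disjoint_letterPositions (k l : ℕ) {x y : ℕ} (h : x ≠ y) :
    Disjoint (letterPositions k x) (letterPositions l y) := by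
  simp only [letterPositions, Finset.disjoint_union_left, Finset.disjoint_union_right]
  refine ⟨⟨?_, ?_⟩, ?_, ?_⟩ <;> exact disjoint_colouredPositions _ _ fun e => h (Prod.ext_iff.1 e).1

/-- The list of all colourings of a word. -/
def wordColourings (w : List ℕ) : List (List (ℕ × ℕ)) :=
  (w.map fun s => [(s, 0), (s, s)]).sections

theorem sum_map_wordColourings_cons {M : Type*} [AddCommMonoid M] (f : List (ℕ × ℕ) → M) (x : ℕ) (w : List ℕ) :
    ((wordColourings (x :: w)).map f).sum =
      ((wordColourings w).map fun a => f ((x, 0) :: a)).sum +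
      ((wordColourings w).map fun a => f ((x, x) :: a)).sum := by
  simp only [wordColourings, List.map_cons, List.map_nil, List.sections]
  induction (w.map fun s => [(s, 0), (s, s)]).sections with
  | nil => simp
  | cons b L ih =>
    simp only [List.flatMap_cons, List.map_append, List.sum_append, ih, List.map_cons,
      List.sum_cons, List.map_nil, List.sum_nil]
    abel

/-- Choosing a position for a letter includes choosing its colour. For `x ≥ 1` the two colours `0`
and `x` are distinct, so nothing is counted twice. -/
theorem chainSum_letterPositions (k : ℕ) (t : ℚ) (w : List ℕ) (hw : ∀ x ∈ w, 1 ≤ x)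
    (p : Position) :
    chainSum (letterPositions k) (positionWeight t) w p =
      ((wordColourings w).map fun a => (a.map fun x => colourWeight t x.2).prod *
        chainSum (colouredPositions k) (fun _ => 1) a p).sum := by
  induction w generalizing p with
  | nil => simp [wordColourings, List.sections, chainSum]
  | cons x w ih =>
    have hx : 1 ≤ x := hw x (by simp)
    have hpart : ∀ c, ∑ r ∈ colouredPositions k (x, c) with p < r, positionWeight t r *
          chainSum (letterPositions k) (positionWeight t) w r =
        ((wordColourings w).map fun a => (((x, c) :: a).map fun x => colourWeight t x.2).prod *
        chainSum (colouredPositions k) (fun _ => 1) ((x, c) :: a) p).sum := by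
      intro c
      simp only [ih (fun y hy => hw y (by simp [hy]))]
      induction wordColourings w with
      | nil => simp
      | cons b L ih' =>
        simp only [List.map_cons, List.sum_cons, mul_add, Finset.sum_add_distrib,
          List.prod_cons] at ih' ⊢
        rw [ih']
        congr 1
        rw [chainSum, Finset.mul_sum]
        refine Finset.sum_congr rfl fun r hr => ?_
        have : positionWeight t r = colourWeight t c := by
          rw [Finset.mem_filter, colouredPositions, Finset.mem_image] at hr
          obtain ⟨⟨v, -, rfl⟩, -⟩ := hr
          rfl
        rw [this]; ring
    rw [sum_map_wordColourings_cons, chainSum, letterPositions, Finset.filter_union,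
      Finset.sum_union, hpart, hpart]
    refine Finset.disjoint_filter_filter (disjoint_colouredPositions _ _ ?_)
    intro h
    simp at h; lia

theorem mem_wordColourings {w : List ℕ} {a : List (ℕ × ℕ)} :
    a ∈ wordColourings w ↔ a.map Prod.fst = w ∧ ∀ x ∈ a, x.2 = 0 ∨ x.2 = x.1 := by
  have h := mem_colourings (P := {w}) (a := a)
  simpa [colourings, wordColourings] using h

theorem nodup_wordColourings {w : List ℕ} (hw : ∀ x ∈ w, 1 ≤ x) : (wordColourings w).Nodup := by
  induction w with
  | nil => simp [wordColourings, List.sections]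
  | cons x w ih =>
    have hx : 1 ≤ x := hw x (by simp)
    have ih := ih fun y hy => hw y (by simp [hy])
    simp only [wordColourings, List.map_cons, List.sections] at ih ⊢
    rw [List.nodup_flatMap]
    refine ⟨fun b _ => ?_, ?_⟩
    · simp; lia
    · refine ih.imp fun {b c} hbc => ?_
      simp [Function.onFun, List.Disjoint, hbc]

theorem sum_colourings {M : Type*} [AddCommMonoid M] (P : Finset (List ℕ))
    (hP : ∀ w ∈ P, ∀ x ∈ w, 1 ≤ x) (f : List (ℕ × ℕ) → M) :
    ∑ a ∈ colourings P, f a = ∑ w ∈ P, ((wordColourings w).map f).sum := by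
  rw [colourings, Finset.sum_biUnion]
  · exact Finset.sum_congr rfl fun w hw => List.sum_toFinset f (nodup_wordColourings (hP w hw))
  · intro u _ v _ huv
    rw [Function.onFun, Finset.disjoint_left]
    intro a ha hb
    rw [List.mem_toFinset] at ha hb
    exact huv ((mem_wordColourings.1 ha).1.symm.trans (mem_wordColourings.1 hb).1)

/-- The nonzero colours are the symbols of the letters that carry them, hence distinct; the palette
therefore counts coloured letters, and the weight is multiplicative. -/
theorem pow_card_paletteStar (t : ℚ) {w : List ℕ} (hn : w.Nodup) {a : List (ℕ × ℕ)}
    (ha : a ∈ wordColourings w) :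
    t ^ (paletteStar a).card = (a.map fun x => colourWeight t x.2).prod := by
  rw [mem_wordColourings] at ha
  obtain ⟨rfl, hc⟩ := ha
  have hprod : ∀ b : List (ℕ × ℕ), (b.map fun x => colourWeight t x.2).prod =
      t ^ ((b.map Prod.snd).filter (· ≠ 0)).length := by
    intro b
    induction b with
    | nil => simp
    | cons x b ih =>
      rw [List.map_cons, List.prod_cons, ih, colourWeight]
      by_cases hx : x.2 = 0
      · simp [hx]
      · simp [hx, pow_succ']
  have hnd : ((a.map Prod.snd).filter (· ≠ 0)).Nodup := by
    rw [List.Nodup, List.pairwise_filter, List.pairwise_map]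
    rw [List.Nodup, List.pairwise_map] at hn
    refine (List.pairwise_iff_forall_sublist.2 fun {x y} hs => ?_)
    have hne := (List.pairwise_iff_forall_sublist.1 hn) hs
    have hx := hc x (hs.subset (by simp))
    have hy := hc y (hs.subset (by simp))
    intro h1 h2
    simp at h1 h2
    lia
  rw [hprod, ← List.toFinset_card_of_nodup hnd]
  congr 2
  ext c
  simp [paletteStar, palette, and_comm]

end Descents

end ColouredShuffle
namespace ColouredShuffle
-- Counting orbits of unitriangular groups over finite chain rings
section Orbits

/-- The inverse class sizes sum to `1` over each class. -/
theorem card_quotient_eq_sum {X : Type*} [Fintype X] (s : Setoid X) :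
    (Nat.card (Quotient s) : ℚ) = ∑ x : X, (Nat.card {y // s y x} : ℚ)⁻¹ := by
  classical
  rw [← Finset.sum_fiberwise (s := Finset.univ) (g := fun x => (Quotient.mk s x)),
    Nat.card_eq_fintype_card, ← Finset.card_univ, Finset.card_eq_sum_ones, Nat.cast_sum]
  refine Finset.sum_congr rfl fun c _ => ?_
  induction c using Quotient.inductionOn with
  | _ x =>
    have hcard : (Finset.univ.filter fun y => Quotient.mk s y = Quotient.mk s x).card =
        Nat.card {y // s y x} := by
      rw [Nat.card_eq_fintype_card, Fintype.card_subtype]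
      congr 1
      ext y
      simp [Quotient.eq]
    have hconst : ∀ z ∈ Finset.univ.filter (fun y => Quotient.mk s y = Quotient.mk s x),
        (Nat.card {y // s y z} : ℚ)⁻¹ = (Nat.card {y // s y x} : ℚ)⁻¹ := by
      intro z hz
      rw [Finset.mem_filter, Quotient.eq] at hz
      congr 2
      refine Nat.card_congr (Equiv.subtypeEquivRight fun y => ?_)
      exact ⟨fun h => s.trans h hz.2, fun h => s.trans h (s.symm hz.2)⟩
    rw [Finset.sum_congr rfl hconst, Finset.sum_const, hcard, nsmul_eq_mul, mul_inv_cancel₀,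
      Nat.cast_one]
    have : Nonempty {y // s y x} := ⟨⟨x, s.refl x⟩⟩
    exact_mod_cast Nat.card_pos.ne'

theorem numOrbits_eq_card_quotient {ι R : Type*} [Fintype ι] [DecidableEq ι] [CommRing R]
    (H : Subgroup (GL ι R)) (s : Setoid (ι → R))
    (h : ∀ x y, s x y ↔ ∃ g ∈ H, Matrix.vecMul y g.1 = x) :
    numOrbits H = Nat.card (Quotient s) := by
  unfold numOrbits
  let := rightMulAction H
  refine Nat.card_congr (Quotient.congrRight fun x y => ?_)
  change MulAction.orbitRel _ _ x y ↔ s x y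
  rw [MulAction.orbitRel_apply, MulAction.mem_orbit_iff, h]
  constructor
  · rintro ⟨g, rfl⟩
    exact ⟨g.unop.1, g.unop.2, rfl⟩
  · rintro ⟨g, hg, rfl⟩
    exact ⟨MulOpposite.op ⟨g, hg⟩, rfl⟩

/-- The orbit equivalence relation of a group of invertible matrices on row vectors. -/
def rowSetoid {ι R : Type*} [Fintype ι] [DecidableEq ι] [CommRing R]
    (H : Subgroup (GL ι R)) : Setoid (ι → R) where
  r x y := ∃ g ∈ H, Matrix.vecMul y g.1 = x
  iseqv := by
    refine ⟨fun x => ⟨1, H.one_mem, Matrix.vecMul_one x⟩, ?_, ?_⟩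
    · rintro x y ⟨g, hg, rfl⟩
      refine ⟨g⁻¹, H.inv_mem hg, ?_⟩
      rw [Matrix.vecMul_vecMul, ← Units.val_mul, mul_inv_cancel, Units.val_one, Matrix.vecMul_one]
    · rintro x y z ⟨g, hg, rfl⟩ ⟨k, hk, rfl⟩
      exact ⟨k * g, H.mul_mem hk hg, (Matrix.vecMul_vecMul z k.1 g.1).symm⟩

theorem rowSetoid_iff {ι R : Type*} [Fintype ι] [DecidableEq ι] [CommRing R]
    (H : Subgroup (GL ι R)) (x y : ι → R) :
    rowSetoid H x y ↔ ∃ g ∈ H, Matrix.vecMul y g.1 = x := Iff.rfl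

theorem numOrbits_blockDiagonal {κ : Type} [Fintype κ] [DecidableEq κ] {ι : κ → Type}
    [∀ k, Fintype (ι k)] [∀ k, DecidableEq (ι k)] {R : Type*} [CommRing R]
    (H : ∀ k, Subgroup (GL (ι k) R)) :
    numOrbits ((Subgroup.pi Set.univ H).map (blockDiagonalGL ι R)) = ∏ k, numOrbits (H k) := by
  rw [numOrbits_eq_card_quotient _ _ (rowSetoid_iff _)]
  simp only [fun k => numOrbits_eq_card_quotient (H k) _ (rowSetoid_iff _)]
  rw [← Nat.card_pi]
  refine Nat.card_congr ((Quotient.congr (Equiv.piCurry fun k (_ : ι k) => R) fun x y => ?_).trans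
    (Setoid.piQuotientEquiv _).symm)
  change rowSetoid _ x y ↔ ∀ k, rowSetoid (H k) (fun j => x ⟨k, j⟩) (fun j => y ⟨k, j⟩)
  have hmul : ∀ (g : ∀ k, GL (ι k) R) (k : κ) (j : ι k),
      Matrix.vecMul y (blockDiagonalGL ι R g).1 ⟨k, j⟩ =
        Matrix.vecMul (fun j => y ⟨k, j⟩) (g k).1 j := by
    intro g k j
    simp only [blockDiagonalGL_coe, Matrix.vecMul, dotProduct, Fintype.sum_sigma]
    rw [Finset.sum_eq_single k]
    · simp
    · intro l _ hl
      exact Finset.sum_eq_zero fun i _ => by rw [Matrix.blockDiagonal'_apply_ne _ _ _ hl, mul_zero]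
    · simp
  simp only [rowSetoid_iff]
  constructor
  · rintro ⟨_, ⟨g, hg, rfl⟩, rfl⟩ k
    exact ⟨g k, hg k (Set.mem_univ k), funext fun j => (hmul g k j).symm⟩
  · intro h
    choose g hg hgx using h
    refine ⟨_, ⟨g, fun k _ => hg k, rfl⟩, funext fun ⟨k, j⟩ => ?_⟩
    rw [hmul, hgx]

variable {R : Type*} [CommRing R]

/-- The ideal generated by `I` and the entries of `y` before the position `j`. -/
def prefixIdeal (I : Ideal R) {d : ℕ} (y : Fin d → R) (j : Fin d) : Ideal R :=
  I ⊔ Ideal.span (y '' Set.Iio j)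

theorem prefixIdeal_cons_zero (I : Ideal R) {d : ℕ} (a : R) (y : Fin d → R) :
    prefixIdeal I (Fin.cons a y : Fin (d + 1) → R) 0 = I := by
  have : Set.Iio (0 : Fin (d + 1)) = ∅ := by ext i; simp
  rw [prefixIdeal, this]
  simp

theorem prefixIdeal_cons_succ (I : Ideal R) {d : ℕ} (a : R) (y : Fin d → R) (j : Fin d) :
    prefixIdeal I (Fin.cons a y : Fin (d + 1) → R) j.succ =
      prefixIdeal (I ⊔ Ideal.span {a}) y j := by
  have : (Fin.cons a y : Fin (d + 1) → R) '' Set.Iio j.succ = {a} ∪ y '' Set.Iio j := by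
    ext r
    simp only [Set.mem_image, Set.mem_Iio, Set.mem_union, Set.mem_singleton_iff, Fin.exists_fin_succ,
      Fin.cons_zero, Fin.cons_succ, Fin.succ_lt_succ_iff, Fin.succ_pos, true_and, eq_comm (a := r)]
  rw [prefixIdeal, prefixIdeal, this, Ideal.span_union, sup_assoc]

/-- The entries above the diagonal are free, and column `j` affects only the `j`-th coordinate, so
the conditions for different `j` are independent. -/
theorem rowSetoid_unitriangular_iff {d : ℕ} (x y : Fin d → R) :
    rowSetoid (unitriangularSubgroup d R) x y ↔ ∀ j, x j - y j ∈ prefixIdeal ⊥ y j := by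
  simp only [rowSetoid_iff, prefixIdeal, bot_sup_eq]
  constructor
  · rintro ⟨g, ⟨h0, h1⟩, rfl⟩ j
    rw [Matrix.vecMul, dotProduct, Fintype.sum_eq_add_sum_compl j, h1, mul_one, add_sub_cancel_left]
    refine Ideal.sum_mem _ fun i hi => ?_
    rcases lt_or_gt_of_ne (show i ≠ j by simpa using hi) with hij | hij
    · exact Ideal.mul_mem_right _ _ (Ideal.subset_span ⟨i, hij, rfl⟩)
    · rw [h0 i j hij, mul_zero]
      exact Ideal.zero_mem _
  · intro h
    simp only [Ideal.span, ← Finset.coe_Iio, Submodule.mem_span_image_finset_iff_exists_fun',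
      smul_eq_mul] at h
    choose c hc using h
    -- Column `j` holds the coefficients expressing `x j - y j` through the earlier entries of `y`.
    let A : Matrix (Fin d) (Fin d) R := fun i j =>
      if i < j then c j i else if i = j then 1 else 0
    have hA0 : ∀ i j, j < i → A i j = 0 := fun i j hij => by
      simp [A, hij.not_gt, hij.ne']
    have hA1 : ∀ i, A i i = 1 := fun i => by simp [A]
    have hdet : A.det = 1 := by
      rw [Matrix.det_of_isUpperTriangular (fun i j hij => hA0 i j hij)]
      simp [hA1]
    refine ⟨Matrix.GeneralLinearGroup.mk'' A (by simp [hdet]), ⟨hA0, hA1⟩, funext fun j => ?_⟩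
    change Matrix.vecMul y A j = x j
    rw [← sub_add_cancel (x j) (y j), ← hc j, Matrix.vecMul, dotProduct,
      Fintype.sum_eq_add_sum_compl j, hA1, mul_one, add_comm]
    congr 1
    have hsub : Finset.Iio j ⊆ {j}ᶜ := fun i hi => by simpa using (Finset.mem_Iio.1 hi).ne
    rw [← Finset.sum_subset hsub]
    · refine Finset.sum_congr rfl fun i hi => ?_
      rw [Finset.mem_Iio] at hi
      simp [A, hi, mul_comm]
    · intro i hi hi'
      simp only [Finset.mem_compl, Finset.mem_singleton, Finset.mem_Iio] at hi hi'
      simp [A, hi, hi']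

/-- A weighted count of vectors whose value at `⊥` is the number of unitriangular orbits. -/
noncomputable def prefixSum [Fintype R] (I : Ideal R) (d : ℕ) : ℚ :=
  ∑ y : Fin d → R, ∏ j, (Nat.card (prefixIdeal I y j) : ℚ)⁻¹

theorem prefixSum_zero [Fintype R] (I : Ideal R) : prefixSum I 0 = 1 := by
  simp [prefixSum]

theorem prefixSum_succ [Fintype R] (I : Ideal R) (d : ℕ) :
    prefixSum I (d + 1) =
      (Nat.card I : ℚ)⁻¹ * ∑ a : R, prefixSum (I ⊔ Ideal.span {a}) d := by
  unfold prefixSum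
  rw [← (Fin.consEquiv fun _ : Fin (d + 1) => R).sum_comp, Fintype.sum_prod_type, Finset.mul_sum]
  refine Finset.sum_congr rfl fun a _ => ?_
  rw [Finset.mul_sum]
  refine Finset.sum_congr rfl fun y _ => ?_
  rw [Fin.prod_univ_succ]
  simp only [Fin.consEquiv, Equiv.coe_fn_mk, prefixIdeal_cons_succ, prefixIdeal_cons_zero]

theorem numOrbits_unitriangularSubgroup [Fintype R] (d : ℕ) :
    (numOrbits (unitriangularSubgroup d R) : ℚ) = prefixSum (⊥ : Ideal R) d := by
  rw [numOrbits_eq_card_quotient _ _ (rowSetoid_iff _), card_quotient_eq_sum, prefixSum]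
  refine Finset.sum_congr rfl fun y _ => ?_
  rw [Finset.prod_inv_distrib, ← Nat.cast_prod, ← Nat.card_pi]
  congr 2
  refine Nat.card_congr ?_
  refine (Equiv.subtypeEquiv (Equiv.subRight y) (q := fun z => ∀ j, z j ∈ prefixIdeal ⊥ y j)
    fun x => ?_).trans (Equiv.subtypePiEquivPi (p := fun j z => z ∈ prefixIdeal ⊥ y j))
  rw [rowSetoid_unitriangular_iff]
  rfl

/-- The power series whose `i`-th coefficient is the number of elements with a given annihilator
of colength `i` in a finite chain ring with residue field of size `q`. -/
noncomputable def valuationSeries (q : ℕ) : ℚ⟦X⟧ :=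
  (1 - PowerSeries.X) * PowerSeries.mk fun n => (q : ℚ) ^ n

theorem coeff_zero_valuationSeries (q : ℕ) : PowerSeries.coeff 0 (valuationSeries q) = 1 := by
  simp [valuationSeries]

theorem coeff_succ_valuationSeries (q i : ℕ) :
    PowerSeries.coeff (i + 1) (valuationSeries q) = (q : ℚ) ^ (i + 1) - (q : ℚ) ^ i := by
  rw [valuationSeries, sub_mul, one_mul, map_sub, PowerSeries.coeff_succ_X_mul,
    PowerSeries.coeff_mk, PowerSeries.coeff_mk]

/-- The ideals `J 0 ⊇ J 1 ⊇ ⋯ ⊇ J k` form the chain of all ideals of a finite chain ring of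
length `k` with residue field of size `q`. -/
structure IsIdealChain (J : ℕ → Ideal R) (k q : ℕ) : Prop where
  antitone : Antitone J
  zero : J 0 = ⊤
  length : J k = ⊥
  card : ∀ l ≤ k, Nat.card (J l) = q ^ (k - l)
  span : ∀ j < k, ∀ x ∈ J j, x ∉ J (j + 1) → Ideal.span {x} = J j

open Classical in
-- Elements of `J l` leave the ideal `J l` unchanged. For `j ≥ 1`, those in `J (l - j)` but not in
-- `J (l - j + 1)` enlarge it to `J (l - j)`, and there are `q^(k - l) * (q^j - q^(j - 1))` of them.
-- Restricting to `J (l - i)` allows induction one layer at a time.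
theorem IsIdealChain.sum_sup_span [Fintype R] {J : ℕ → Ideal R} {k q : ℕ}
    (hJ : IsIdealChain J k q) (f : Ideal R → ℚ) {l : ℕ} (hl : l ≤ k) (i : ℕ) (hi : i ≤ l) :
    ∑ x with x ∈ J (l - i), f (J l ⊔ Ideal.span {x}) =
      (q : ℚ) ^ (k - l) * ∑ j ∈ Finset.range (i + 1),
        PowerSeries.coeff j (valuationSeries q) * f (J (l - j)) := by
  have hcard : ∀ l ≤ k, ((Finset.univ.filter (· ∈ J l)).card : ℚ) = (q : ℚ) ^ (k - l) := by
    intro l hl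
    rw [← Nat.cast_pow, ← hJ.card l hl, Nat.card_eq_fintype_card, Fintype.card_subtype]
  induction i with
  | zero =>
    rw [Finset.sum_congr rfl (g := fun _ => f (J l))]
    · simp [hcard l hl, coeff_zero_valuationSeries]
    · intro x hx
      rw [sup_of_le_left]
      rw [Ideal.span_singleton_le_iff_mem]
      simpa using hx
  | succ i ih =>
    have hle : J (l - i) ≤ J (l - (i + 1)) := hJ.antitone (by lia)
    have hsub : Finset.univ.filter (· ∈ J (l - i)) ⊆
        Finset.univ.filter (· ∈ J (l - (i + 1))) := by
      intro x
      simpa using @hle x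
    rw [← Finset.sum_sdiff hsub, ih (by lia), Finset.sum_range_succ _ (i + 1), mul_add, add_comm]
    congr 1
    rw [Finset.sum_congr rfl (g := fun _ => f (J (l - (i + 1))))]
    · rw [Finset.sum_const, nsmul_eq_mul, ← mul_assoc, Finset.card_sdiff_of_subset hsub,
        Nat.cast_sub (Finset.card_le_card hsub), hcard _ (by lia), hcard _ (by lia),
        coeff_succ_valuationSeries, mul_sub, ← pow_add, ← pow_add]
      congr 4 <;> lia
    · intro x hx
      simp only [Finset.mem_sdiff, Finset.mem_filter, Finset.mem_univ, true_and] at hx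
      rw [hJ.span (l - (i + 1)) (by lia) x hx.1, sup_of_le_right (hJ.antitone (by lia))]
      rw [show l - (i + 1) + 1 = l - i by lia]
      exact hx.2

/-- The factor `q^(k - l)` from the layer count cancels the inverse size of `J l`, leaving a pure
convolution. -/
theorem IsIdealChain.prefixSum_eq_coeff [Fintype R] {J : ℕ → Ideal R} {k q : ℕ} (hq : q ≠ 0)
    (hJ : IsIdealChain J k q) (d : ℕ) {l : ℕ} (hl : l ≤ k) :
    prefixSum (J l) d = PowerSeries.coeff l (valuationSeries q ^ d * PowerSeries.mk 1) := by
  induction d generalizing l with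
  | zero => simp [prefixSum_zero]
  | succ d ih =>
    classical
    -- Taking `i = l` makes the sum run over `J 0 = ⊤`, the whole ring.
    have h := hJ.sum_sup_span (fun I => prefixSum I d) hl l le_rfl
    rw [Nat.sub_self, hJ.zero] at h
    simp only [Submodule.mem_top, Finset.filter_true] at h
    rw [prefixSum_succ, h, hJ.card l hl, Nat.cast_pow, inv_mul_cancel_left₀ (by positivity),
      pow_succ', mul_assoc, PowerSeries.coeff_mul, Finset.Nat.sum_antidiagonal_eq_sum_range_succ_mk]
    refine Finset.sum_congr rfl fun j _ => ?_
    rw [ih (by lia)]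

end Orbits

/-! ### Quotients of a discrete valuation ring and their zeta functions -/

section DiscreteValuationRing

variable {O : Type*} [CommRing O] [IsDomain O] [IsDiscreteValuationRing O]

open IsLocalRing

theorem card_quotient_maximalIdeal_pow (k : ℕ) :
    Nat.card (O ⧸ maximalIdeal O ^ k) = Nat.card (ResidueField O) ^ k := by
  have h := cardQuot_pow_of_prime (P := maximalIdeal O)
    (IsDiscreteValuationRing.not_a_field O) (i := k)
  rw [Submodule.cardQuot_apply, Submodule.cardQuot_apply] at h
  exact h

theorem span_singleton_eq_maximalIdeal_pow {j : ℕ} {y : O} (h : y ∈ maximalIdeal O ^ j)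
    (h' : y ∉ maximalIdeal O ^ (j + 1)) : Ideal.span {y} = maximalIdeal O ^ j := by
  obtain ⟨ϖ, hϖ⟩ := IsDiscreteValuationRing.exists_irreducible O
  rw [hϖ.maximalIdeal_eq, Ideal.span_singleton_pow, Ideal.mem_span_singleton] at *
  obtain ⟨c, rfl⟩ := h
  have hc : IsUnit c := by
    by_contra hc
    rw [← mem_nonunits_iff, ← mem_maximalIdeal, hϖ.maximalIdeal_eq,
      Ideal.mem_span_singleton] at hc
    obtain ⟨e, rfl⟩ := hc
    exact h' ⟨e, by ring⟩
  rw [Ideal.span_singleton_mul_right_unit hc]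

theorem isIdealChain_quotient [Finite (ResidueField O)] (k : ℕ) :
    IsIdealChain (fun l => (maximalIdeal O ^ l).map (Ideal.Quotient.mk (maximalIdeal O ^ k))) k
      (Nat.card (ResidueField O)) where
  antitone i j h := Ideal.map_mono (Ideal.pow_le_pow_right h)
  zero := by simp [Ideal.one_eq_top, Ideal.map_top]
  length := Ideal.map_quotient_self _
  card l hl := by
    have hle : maximalIdeal O ^ k ≤ maximalIdeal O ^ l := Ideal.pow_le_pow_right hl
    have h1 := Submodule.card_eq_card_quotient_mul_card
      ((maximalIdeal O ^ l).map (Ideal.Quotient.mk (maximalIdeal O ^ k)))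
    rw [Nat.card_congr (DoubleQuot.quotQuotEquivQuotOfLE hle).toEquiv,
      card_quotient_maximalIdeal_pow, card_quotient_maximalIdeal_pow] at h1
    have hpos : 0 < Nat.card (ResidueField O) ^ l := pow_pos Nat.card_pos _
    refine Nat.eq_of_mul_eq_mul_left hpos ?_
    rw [← pow_add, Nat.add_sub_cancel' hl, h1, mul_comm]
  span j _ x hx hx' := by
    rw [Ideal.mem_map_iff_of_surjective _ Ideal.Quotient.mk_surjective] at hx
    obtain ⟨y, hy, rfl⟩ := hx
    have hy' : y ∉ maximalIdeal O ^ (j + 1) := fun h => hx' (Ideal.mem_map_of_mem _ h)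
    rw [← span_singleton_eq_maximalIdeal_pow hy hy', Ideal.map_span, Set.image_singleton]

theorem orbitZeta_unitriangular [Finite (ResidueField O)] (d : ℕ) :
    orbitZeta (unitriangular O d) =
      valuationSeries (Nat.card (ResidueField O)) ^ d * PowerSeries.mk 1 := by
  ext k
  have hfin : Finite (O ⧸ maximalIdeal O ^ k) := by
    refine Nat.finite_of_card_ne_zero ?_
    rw [card_quotient_maximalIdeal_pow]
    exact pow_ne_zero _ Nat.card_pos.ne'
  have := Fintype.ofFinite (O ⧸ maximalIdeal O ^ k)
  rw [orbitZeta, PowerSeries.coeff_mk]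
  change (numOrbits (unitriangularSubgroup d _) : ℚ) = _
  rw [numOrbits_unitriangularSubgroup, ← (isIdealChain_quotient k).length,
    (isIdealChain_quotient k).prefixSum_eq_coeff Nat.card_pos.ne' d le_rfl]

theorem mk_one_mul_one_sub_X : (PowerSeries.mk 1 * (1 - PowerSeries.X) : ℚ⟦X⟧) = 1 :=
  PowerSeries.mk_one_mul_one_sub_eq_one ℚ

theorem rescale_orbitZeta_unitriangular [Finite (ResidueField O)] (d : ℕ) :
    PowerSeries.rescale ((Nat.card (ResidueField O) : ℚ) ^ (-1 : ℤ))
        (orbitZeta (unitriangular O (d + 1))) =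
      (1 - PowerSeries.C (Nat.card (ResidueField O) : ℚ)⁻¹ * PowerSeries.X) ^ d *
        PowerSeries.mk 1 ^ (d + 1) := by
  have hq : (Nat.card (ResidueField O) : ℚ) ≠ 0 := by exact_mod_cast Nat.card_pos.ne'
  have h : orbitZeta (unitriangular O (d + 1)) = (1 - PowerSeries.X) ^ d *
      (PowerSeries.mk fun n => (Nat.card (ResidueField O) : ℚ) ^ n) ^ (d + 1) := by
    rw [orbitZeta_unitriangular, valuationSeries, mul_pow]
    linear_combination ((1 - PowerSeries.X) ^ d *
      (PowerSeries.mk fun n => (Nat.card (ResidueField O) : ℚ) ^ n) ^ (d + 1)) *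
        mk_one_mul_one_sub_X
  rw [h, map_mul, map_pow, map_pow, map_sub, map_one, PowerSeries.rescale_X, zpow_neg_one]
  congr 2
  ext n
  simp [PowerSeries.coeff_rescale, hq]

end DiscreteValuationRing
end ColouredShuffle
namespace ColouredShuffle

/-! ### Iterated shuffles and Hadamard products -/

section BlockShuffles

theorem chainSum_letterPositions_eq_coeff (k : ℕ) (t : ℚ) {w : List ℕ} (hw : ∀ x ∈ w, 1 ≤ x)
    (hn : w.Nodup) :
    chainSum (letterPositions k) (positionWeight t) w (position 0 (0, 0)) =
      PowerSeries.coeff k (((wordColourings w).map fun a =>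
        PowerSeries.C (t ^ (paletteStar a).card) * PowerSeries.X ^ des a).sum *
          PowerSeries.mk 1 ^ (w.length + 1)) := by
  rw [chainSum_letterPositions k t w hw, ← List.sum_map_mul_right, map_list_sum, List.map_map]
  congr 1
  refine List.map_congr_left fun a ha => ?_
  rw [Function.comp_apply, mul_assoc, PowerSeries.coeff_C_mul, pow_card_paletteStar t hn ha,
    des_eq_desAfter]
  rw [mem_wordColourings] at ha
  obtain ⟨rfl, -⟩ := ha
  rw [chainSum_colouredPositions k a 0 (Nat.zero_le k) (0, 0), Nat.sub_zero, List.length_map]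
  rw [List.map_cons, List.nodup_cons]
  exact ⟨fun h => absurd (hw 0 h) (by simp), hn⟩

/-- In an increasing word, a letter of colour `0` is never a descent, and a letter coloured by
itself always is one: its colour exceeds that of its predecessor. Each letter thus contributes `1 +
tX`. -/
theorem sum_wordColourings_of_increasing (t : ℚ) (w : List ℕ) (x : ℕ × ℕ)
    (hx : x.2 = 0 ∨ x.2 = x.1) (h : (x.1 :: w).Pairwise (· < ·)) :
    ((wordColourings w).map fun a => PowerSeries.C ((a.map fun y => colourWeight t y.2).prod) *
        (PowerSeries.X : ℚ⟦X⟧) ^ desAfter x a).sum =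
      (1 + PowerSeries.C t * PowerSeries.X) ^ w.length := by
  induction w generalizing x with
  | nil => simp [wordColourings, List.sections, desAfter]
  | cons y w ih =>
    have hxy : x.1 < y := by simp at h; exact h.1.1
    rw [List.pairwise_cons] at h
    have h0 : ¬ colourLT (y, 0) x := by simp [colourLT]; lia
    have h1 : colourLT (y, y) x := by simp [colourLT]; lia
    have hy : y ≠ 0 := by lia
    rw [sum_map_wordColourings_cons]
    simp only [List.map_cons, List.prod_cons, desAfter, h0, h1, if_true, if_false, colourWeight,
      hy, zero_add, one_mul, map_mul, pow_add, pow_one]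
    have ih0 := ih (y, 0) (Or.inl rfl) h.2
    have ih1 := ih (y, y) (Or.inr rfl) h.2
    simp only [colourWeight] at ih0 ih1
    rw [ih0, List.length_cons, pow_succ', add_mul, one_mul, ← ih1, ← List.sum_map_mul_left]
    congr 3
    funext a
    ring

theorem chainSum_range' (k : ℕ) (t : ℚ) (D d : ℕ) :
    chainSum (letterPositions k) (positionWeight t) (List.range' (D + 1) d)
        (position 0 (0, 0)) =
      PowerSeries.coeff k
        ((1 + PowerSeries.C t * PowerSeries.X) ^ d * PowerSeries.mk 1 ^ (d + 1)) := by
  have hmem : ∀ x ∈ List.range' (D + 1) d, 1 ≤ x := fun x hx => by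
    rw [List.mem_range'_1] at hx; lia
  rw [chainSum_letterPositions_eq_coeff k t hmem List.nodup_range']
  have h := sum_wordColourings_of_increasing t (List.range' (D + 1) d) (0, 0) (Or.inl rfl)
    (List.pairwise_cons.2 ⟨fun x hx => hmem x hx, List.pairwise_lt_range'⟩)
  rw [List.length_range'] at h ⊢
  rw [← h]
  congr 3
  refine List.map_congr_left fun a ha => ?_
  rw [pow_card_paletteStar t List.nodup_range' ha, des_eq_desAfter]

theorem partialSum_succ {n : ℕ} (d : Fin (n + 1) → ℕ) :
    partialSum d (n + 1) = partialSum (fun i => d i.castSucc) n + d (Fin.last n) := by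
  simp only [partialSum, Fin.is_lt, Finset.filter_true, Fin.sum_univ_castSucc]

theorem partialSum_castSucc {n : ℕ} (d : Fin (n + 1) → ℕ) {i : ℕ} (hi : i ≤ n) :
    partialSum d i = partialSum (fun i => d i.castSucc) i := by
  simp only [partialSum, Finset.sum_filter, Fin.sum_univ_castSucc, Fin.val_castSucc, Fin.val_last,
    if_neg hi.not_gt, add_zero]

theorem blockShuffle_zero (d : Fin 0 → ℕ) : blockShuffle d = {[]} := rfl

theorem blockShuffle_succ {n : ℕ} (d : Fin (n + 1) → ℕ) :
    blockShuffle d = (blockShuffle fun i => d i.castSucc).biUnion fun u =>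
      (shuffles u (List.range' (partialSum (fun i => d i.castSucc) n + 1)
        (d (Fin.last n)))).toFinset := by
  rw [blockShuffle, List.ofFn_succ', List.concat_eq_append, List.foldl_append]
  simp only [List.foldl_cons, List.foldl_nil, shuffleSet, Finset.singleton_biUnion, Fin.val_last,
    Fin.val_castSucc, partialSum_castSucc d le_rfl, fun i : Fin n => partialSum_castSucc d i.2.le]
  rfl

theorem blockShuffle_subset {n : ℕ} (d : Fin n → ℕ) :
    blockShuffle d ⊆ symmWords (partialSum d n) := by
  induction n with
  | zero => simp [blockShuffle_zero, partialSum, mem_symmWords]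
  | succ n ih =>
    intro w hw
    rw [blockShuffle_succ, Finset.mem_biUnion] at hw
    obtain ⟨u, hu, hw⟩ := hw
    have hu := mem_symmWords.1 (ih _ hu)
    rw [List.mem_toFinset] at hw
    rw [mem_symmWords, partialSum_succ]
    refine (perm_append_of_mem_shuffles hw).trans ((hu.append_right _).trans ?_)
    rw [add_comm _ 1, List.range'_append_1]

theorem one_le_and_le_of_mem_symmWords {N : ℕ} {w : List ℕ} (hw : w ∈ symmWords N) {x : ℕ}
    (hx : x ∈ w) : 1 ≤ x ∧ x ≤ N := by
  have := (mem_symmWords.1 hw).subset hx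
  rw [List.mem_range'_1] at this
  lia

theorem length_of_mem_symmWords {N : ℕ} {w : List ℕ} (hw : w ∈ symmWords N) : w.length = N := by
  rw [(mem_symmWords.1 hw).length_eq, List.length_range']

/-- No multiplicities occur: the last block uses only letters above `N`, so the letters at most `N`
of a shuffle recover `u`. -/
theorem sum_blockShuffle_succ {M : Type*} [AddCommMonoid M] {n : ℕ} (d : Fin (n + 1) → ℕ)
    (f : List ℕ → M) :
    ∑ w ∈ blockShuffle d, f w = ∑ u ∈ blockShuffle fun i => d i.castSucc,
      ((shuffles u (List.range' (partialSum (fun i => d i.castSucc) n + 1)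
        (d (Fin.last n)))).map f).sum := by
  set N := partialSum (fun i : Fin n => d i.castSucc) n
  rw [blockShuffle_succ, Finset.sum_biUnion]
  · refine Finset.sum_congr rfl fun u hu => List.sum_toFinset f (nodup_shuffles ?_)
    intro x hx hx'
    have := one_le_and_le_of_mem_symmWords (blockShuffle_subset _ hu) hx
    rw [List.mem_range'_1] at hx'
    lia
  · intro u hu v hv huv
    rw [Function.onFun, Finset.disjoint_left]
    intro c hc hc'
    rw [List.mem_toFinset] at hc hc'
    have key : ∀ u ∈ blockShuffle fun i => d i.castSucc,
        c ∈ shuffles u (List.range' (N + 1) (d (Fin.last n))) →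
        c.filter (fun x => decide (x ≤ N)) = u := by
      intro u hu hc
      refine filter_of_mem_shuffles _ (fun x hx => ?_) (fun x hx => ?_) hc
      · simpa using (one_le_and_le_of_mem_symmWords (blockShuffle_subset _ hu) hx).2
      · rw [List.mem_range'_1] at hx
        simp; lia
    exact huv ((key u hu hc).symm.trans (key v hv hc'))

theorem card_blockShuffle {n : ℕ} (d : Fin n → ℕ) :
    (blockShuffle d).card = ∏ i : Fin n, (partialSum d (i + 1)).choose (partialSum d i) := by
  induction n with
  | zero => simp [blockShuffle_zero]
  | succ n ih =>
    rw [Finset.card_eq_sum_ones, sum_blockShuffle_succ, Fin.prod_univ_castSucc, Fin.val_last,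
      partialSum_succ, partialSum_castSucc d le_rfl]
    simp only [Fin.val_castSucc, partialSum_castSucc d (Fin.is_lt _).le,
      fun i : Fin n => partialSum_castSucc d i.2]
    rw [← ih, ← smul_eq_mul, ← Finset.sum_const]
    refine Finset.sum_congr rfl fun u hu => ?_
    rw [List.map_const', List.sum_replicate, smul_eq_mul, mul_one, length_shuffles,
      List.length_range', length_of_mem_symmWords (blockShuffle_subset _ hu)]

theorem sum_chainSum_blockShuffle (k : ℕ) (t : ℚ) (p : Position) {n : ℕ} (d : Fin n → ℕ) :
    ∑ w ∈ blockShuffle d, chainSum (letterPositions k) (positionWeight t) w p =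
      ∏ i : Fin n, chainSum (letterPositions k) (positionWeight t)
        (List.range' (partialSum d i + 1) (d i)) p := by
  induction n with
  | zero => simp [blockShuffle_zero, chainSum]
  | succ n ih =>
    rw [sum_blockShuffle_succ, Fin.prod_univ_castSucc, Fin.val_last, partialSum_castSucc d le_rfl]
    simp only [Fin.val_castSucc, fun i : Fin n => partialSum_castSucc d i.2.le]
    rw [← ih, Finset.sum_mul]
    refine Finset.sum_congr rfl fun u hu => ?_
    rw [chainSum_mul_chainSum]
    intro x hx y hy
    refine disjoint_letterPositions _ _ ?_
    have := one_le_and_le_of_mem_symmWords (blockShuffle_subset _ hu) hx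
    rw [List.mem_range'_1] at hy
    lia

/-- Both sides are compared at `X^k`: the right is a product of chain sums of the blocks, the left a
sum of chain sums over their shuffles. -/
theorem sum_colourings_blockShuffle_eq (t : ℚ) {n : ℕ} (d : Fin n → ℕ) :
    (∑ a ∈ colourings (blockShuffle d),
        PowerSeries.C (t ^ (paletteStar a).card) * PowerSeries.X ^ des a) *
          PowerSeries.mk 1 ^ (partialSum d n + 1) =
      hadamardProd fun i : Fin n =>
        (1 + PowerSeries.C t * PowerSeries.X) ^ d i * PowerSeries.mk 1 ^ (d i + 1) := by
  have hpos : ∀ w ∈ blockShuffle d, ∀ x ∈ w, 1 ≤ x := fun w hw x hx =>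
    (one_le_and_le_of_mem_symmWords (blockShuffle_subset d hw) hx).1
  ext k
  rw [hadamardProd, PowerSeries.coeff_mk]
  rw [← Finset.prod_congr rfl fun (i : Fin n) _ => chainSum_range' k t (partialSum d i) (d i),
    ← sum_chainSum_blockShuffle, sum_colourings _ hpos, Finset.sum_mul, map_sum]
  refine Finset.sum_congr rfl fun w hw => ?_
  have hw' := blockShuffle_subset d hw
  rw [chainSum_letterPositions_eq_coeff k t (hpos w hw)
    ((mem_symmWords.1 hw').nodup_iff.2 List.nodup_range'), length_of_mem_symmWords hw']

theorem rescale_orbitZeta_prod {O : Type*} [CommRing O] [IsLocalRing O] {n : ℕ} {ι : Fin n → Type}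
    [∀ k, Fintype (ι k)] [∀ k, DecidableEq (ι k)] (G : ∀ k, LinearGroupScheme O (ι k)) (q : ℚ) :
    PowerSeries.rescale (q ^ (-(n : ℤ))) (orbitZeta (LinearGroupScheme.prod G)) =
      hadamardProd fun i => PowerSeries.rescale (q ^ (-1 : ℤ)) (orbitZeta (G i)) := by
  ext k
  simp only [hadamardProd, PowerSeries.coeff_mk, PowerSeries.coeff_rescale, orbitZeta,
    Finset.prod_mul_distrib, Finset.prod_const, Finset.card_univ, Fintype.card_fin]
  congr 1
  · rw [zpow_neg, zpow_natCast, zpow_neg_one, ← inv_pow, pow_right_comm]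
  · rw [← Nat.cast_prod, ← numOrbits_blockDiagonal]
    rfl

/-- In the adic topology the maximal ideal is an open subgroup, which has finite index in a compact
group. -/
theorem finite_residueField {O : Type*} [CommRing O] [IsLocalRing O] [TopologicalSpace O]
    [IsTopologicalRing O] [CompactSpace O] (hO : IsAdic (IsLocalRing.maximalIdeal O)) :
    Finite (IsLocalRing.ResidueField O) := by
  have h := (isAdic_iff.1 hO).1 1
  rw [pow_one] at h
  exact AddSubgroup.quotient_finite_of_isOpen (IsLocalRing.maximalIdeal O).toAddSubgroup h

end BlockShuffles
end ColouredShuffle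

theorem mainTheorem5 {O : Type*} [CommRing O] [IsDomain O] [IsDiscreteValuationRing O]
    [TopologicalSpace O] [IsTopologicalRing O] [CompactSpace O]
    (hO : IsAdic (IsLocalRing.maximalIdeal O))
    (q : ℕ) (hq : q = Nat.card (IsLocalRing.ResidueField O))
    {n : ℕ} (d : Fin n → ℕ) (m : ℕ) (hm : m = Finset.univ.sup d)
    (hgcd : Nat.gcd q (Nat.factorial (m - 1)) = 1) :
    ColouredShuffle.blockShuffle d ⊆
        ColouredShuffle.symmWords (ColouredShuffle.partialSum d n) ∧
      (ColouredShuffle.blockShuffle d).card =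
        ∏ i : Fin n, Nat.choose (ColouredShuffle.partialSum d (i + 1))
          (ColouredShuffle.partialSum d i) ∧
      PowerSeries.rescale ((q : ℚ) ^ (-(n : ℤ)))
          (ColouredShuffle.orbitZeta
            (ColouredShuffle.LinearGroupScheme.prod fun i : Fin n =>
              ColouredShuffle.unitriangular O (d i + 1))) =
        ColouredShuffle.hadamardProd (fun i : Fin n =>
          PowerSeries.rescale ((q : ℚ) ^ (-1 : ℤ))
            (ColouredShuffle.orbitZeta (ColouredShuffle.unitriangular O (d i + 1)))) ∧
      ColouredShuffle.hadamardProd (fun i : Fin n =>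
          PowerSeries.rescale ((q : ℚ) ^ (-1 : ℤ))
            (ColouredShuffle.orbitZeta (ColouredShuffle.unitriangular O (d i + 1)))) =
        (∑ a ∈ ColouredShuffle.colourings (ColouredShuffle.blockShuffle d),
            PowerSeries.C ((-(q : ℚ)) ^ (-((ColouredShuffle.paletteStar a).card : ℤ))) *
              PowerSeries.X ^ ColouredShuffle.des a) *
          ((1 - PowerSeries.X) ^ (ColouredShuffle.partialSum d n + 1))⁻¹ := by
  open ColouredShuffle in
  have : Finite (IsLocalRing.ResidueField O) := finite_residueField hO
  have hinv : ∀ N : ℕ, ((1 - PowerSeries.X : ℚ⟦X⟧) ^ N)⁻¹ = PowerSeries.mk 1 ^ N := by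
    intro N
    rw [eq_comm, PowerSeries.eq_inv_iff_mul_eq_one (by simp), ← mul_pow, mk_one_mul_one_sub_X,
      one_pow]
  refine ⟨blockShuffle_subset d, card_blockShuffle d, rescale_orbitZeta_prod _ _, ?_⟩
  -- Here `t = (-q)⁻¹`, which is the source of the sign in the weight `(-q)^(-|pal*|)`.
  have hz : ∀ i : Fin n, PowerSeries.rescale ((q : ℚ) ^ (-1 : ℤ))
      (orbitZeta (unitriangular O (d i + 1))) =
        (1 + PowerSeries.C (-(q : ℚ))⁻¹ * PowerSeries.X) ^ d i * PowerSeries.mk 1 ^ (d i + 1) := by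
    intro i
    rw [hq, rescale_orbitZeta_unitriangular, inv_neg, map_neg, neg_mul, ← sub_eq_add_neg]
  simp only [hz, hinv]
  simp only [zpow_neg, zpow_natCast, ← inv_pow]
  exact (sum_colourings_blockShuffle_eq _ d).symm
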